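/- Let $n\ge 2$, $1\le p\le 2$ and $\sigma>0$ with $2\sigma>\frac np$. Let $\mu$ be a finite complex Borel measure on $\mathbb{R}^n$ with $\int_{\mathbb{R}^n}d\mu=1$ whose Fourier transform $\widehat\mu(\xi)=\int_{\mathbb{R}^n}e^{-i x\cdot\xi}\,d\mu(x)$ satisfies \[ c\,\min\{1,|\xi|^{2\sigma}\}\le|1-\widehat\mu(\xi)|\le C\,\min\{1,|\xi|^{2\sigma}\}\qquad(\xi\in\mathbb{R}^n) \] for some constants $c,C>0$ (that is, $\mu\in\mathcal K_\sigma$). For $t>0$ put $M_\mu^t f(x)=\int_{\mathbb{R}^n}f(x-ty)\,d\mu(y)$. Let $f\in L^p(\mathbb{R}^n)$ be complex-valued and suppose that for some $\alpha$ with $\frac np<\alpha\le 2\sigma$, \[ \|M_\mu^t f-f\|_{L^p(\mathbb{R}^n)}=O(t^\alpha)\qquad(t\to0^+). \] Then the Fourier transform $\widehat f$ (given by $\widehat f(\xi)=\int_{\mathbb{R}^n}f(x)e^{-i x\cdot\xi}\,dx$ on $L^1$, by Plancherel extension on $L^2$, and on $L^p\subset L^1+L^2$ by linearity) belongs to $L^1(\mathbb{R}^n)$,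 and Fourier inversion holds almost everywhere: \[ f(x)=\frac1{(2\pi)^n}\int_{\mathbb{R}^n}\widehat f(\xi)\,e^{i x\cdot\xi}\,d\xi\qquad\text{for almost every }x\in\mathbb{R}^n . \] -/

import Mathlib

open MeasureTheory FourierTransform
open scoped ENNReal Topology

noncomputable section

namespace FourierGrowth

/-- Euclidean space `ℝⁿ`. -/
abbrev E (n : ℕ) := EuclideanSpace ℝ (Fin n)

variable {n : ℕ}

/-- A complex measure has finite total variation, so that bounded measurable functions are
integrable against it. -/
instance isFiniteMeasure_variation {X : Type*} [MeasurableSpace X] (μ : ComplexMeasure X) :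
    IsFiniteMeasure μ.variation := by
  have key : μ.variation ≤
      (ComplexMeasure.re μ).totalVariation + (ComplexMeasure.im μ).totalVariation := by
    apply VectorMeasure.variation_le_of_forall_enorm_le
    intro s _
    have h1 := SignedMeasure.enorm_le_totalVariation (ComplexMeasure.re μ) s
    have h2 := SignedMeasure.enorm_le_totalVariation (ComplexMeasure.im μ) s
    have e : μ s = (((ComplexMeasure.re μ) s : ℝ) : ℂ)
        + (((ComplexMeasure.im μ) s : ℝ) : ℂ) * Complex.I := by
      exact (Complex.re_add_im (μ s)).symm
    rw [Measure.add_apply, e]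
    refine (enorm_add_le _ _).trans (add_le_add ?_ ?_)
    · refine le_trans (le_of_eq ?_) h1
      simp [enorm_eq_nnnorm]
    · refine le_trans (le_of_eq ?_) h2
      simp [enorm_eq_nnnorm]
  exact isFiniteMeasure_of_le _ key

/-- The integral `∫ g dμ` of a complex function against a complex Borel measure on `ℝⁿ`. -/
def cintegral (μ : ComplexMeasure (E n)) (g : E n → ℂ) : ℂ :=
  μ.integral g (ContinuousLinearMap.mul ℝ ℂ)

/-- The Fourier transform of a measure, `μ̂(ξ) = ∫ e^{-i x·ξ} dμ(x)`. -/
def measureFourier (μ : ComplexMeasure (E n)) (ξ : E n) : ℂ :=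
  cintegral μ fun x => Complex.exp (-(Complex.I * (inner ℝ x ξ : ℝ)))

/-- The class `K_σ`: finite (complex) Borel measures of total integral one with
`|1 - μ̂(ξ)| ≍ min {1, |ξ|^{2σ}}` on `ℝⁿ`. -/
structure IsKClass (σ : ℝ) (μ : ComplexMeasure (E n)) : Prop where
  sigma_pos : 0 < σ
  integral_one : cintegral μ (fun _ => 1) = 1
  estimate : ∃ c C : ℝ, 0 < c ∧ 0 < C ∧ ∀ ξ : E n,
    c * min 1 (‖ξ‖ ^ (2 * σ)) ≤ ‖1 - measureFourier μ ξ‖ ∧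
      ‖1 - measureFourier μ ξ‖ ≤ C * min 1 (‖ξ‖ ^ (2 * σ))

/-- The operator `M_μ^t f (x) = ∫ f (x - t y) dμ(y)`. -/
def averageOp (μ : ComplexMeasure (E n)) (t : ℝ) (f : E n → ℂ) (x : E n) : ℂ :=
  cintegral μ fun y => f (x - t • y)

/-- The Fourier transform on `L¹`, `f̂(ξ) = ∫ f(x) e^{-i x·ξ} dx`. -/
def fourierL1 (f : E n → ℂ) (ξ : E n) : ℂ :=
  ∫ x, f x * Complex.exp (-(Complex.I * (inner ℝ x ξ : ℝ)))

open Classical in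
/-- The (Plancherel) Fourier transform on `L²`, in the normalization of `fourierL1`: Mathlib's
Fourier transform on `L²` extends `f ↦ ∫ f(x) e^{-2π i x·ξ} dx`, whence the factor `(2π)⁻¹`. -/
def fourierL2 (f : E n → ℂ) (ξ : E n) : ℂ :=
  if h : MemLp f 2 (volume : Measure (E n)) then
    (𝓕 (h.toLp f) : Lp ℂ 2 (volume : Measure (E n))) ((2 * Real.pi)⁻¹ • ξ)
  else 0

/-- The Fourier transform on `Lᵖ`, `1 ≤ p ≤ 2`, through `Lᵖ ⊆ L¹ + L²`: the function `f` is the sum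
of `f · 1_{|f| > 1} ∈ L¹` and `f · 1_{|f| ≤ 1} ∈ L²`, and `f̂` is the sum of the transforms of the
two pieces. Up to null sets, any other decomposition gives the same function
(`fourierLp_eq_of_decomposition`). -/
def fourierLp (f : E n → ℂ) (ξ : E n) : ℂ :=
  fourierL1 ({x | 1 < ‖f x‖}.indicator f) ξ + fourierL2 ({x | ‖f x‖ ≤ 1}.indicator f) ξ

theorem fourierL1_eq (f : E n → ℂ) (ξ : E n) : fourierL1 f ξ = 𝓕 f ((2 * Real.pi)⁻¹ • ξ) := by
  rw [Real.fourier_eq', fourierL1]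
  refine integral_congr_ae (Filter.Eventually.of_forall fun x => ?_)
  have hpi : (Real.pi : ℂ) ≠ 0 := by exact_mod_cast Real.pi_ne_zero
  simp only [inner_smul_right, smul_eq_mul]
  rw [mul_comm]
  congr 2
  push_cast
  field_simp

theorem fourier_ae_eq {u : E n → ℂ} (h1 : Integrable u volume) (h2 : MemLp u 2 volume) :
    𝓕 u =ᵐ[volume] (𝓕 (h2.toLp u) : Lp ℂ 2 (volume : Measure (E n))) := by
  have hc : Continuous (𝓕 u) :=
    VectorFourier.fourierIntegral_continuous Real.continuous_fourierChar
      (innerSL ℝ).continuous₂ h1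
  apply ae_eq_of_integral_contDiff_smul_eq hc.locallyIntegrable
    ((Lp.memLp (𝓕 (h2.toLp u) : Lp ℂ 2 (volume : Measure (E n)))).locallyIntegrable (by norm_num))
  intro g hg hgc
  have hgc' : HasCompactSupport (fun x => (g x : ℂ)) := hgc.comp_left (g := fun r : ℝ => (r : ℂ)) rfl
  let G : SchwartzMap (E n) ℂ := hgc'.toSchwartzMap (Complex.ofRealCLM.contDiff.comp hg)
  have hG : ∀ x, G x = (g x : ℂ) := fun x => rfl
  have e1 : ∫ x, G x • 𝓕 u x = ∫ x, 𝓕 G x • u x := by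
    have := VectorFourier.integral_fourierIntegral_smul_eq_flip (L := innerₗ (E n)) (μ := volume)
      (ν := volume) Real.continuous_fourierChar continuous_inner h1 G.integrable
    simp only [flip_innerₗ] at this
    simp only [smul_eq_mul] at this ⊢
    rw [SchwartzMap.fourier_coe]
    calc ∫ x, G x * 𝓕 u x = ∫ x, 𝓕 u x * G x := by simp only [mul_comm]
      _ = ∫ x, u x * 𝓕 (G : E n → ℂ) x := this
      _ = _ := by simp only [mul_comm]
  have e2 := congrArg (fun T => T G) (Lp.fourier_toTemperedDistribution_eq (h2.toLp u))
  simp only [TemperedDistribution.fourier_apply, Lp.toTemperedDistribution_apply] at e2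
  have e3 : ∫ x, 𝓕 G x • (h2.toLp u : E n → ℂ) x = ∫ x, 𝓕 G x • u x := by
    refine integral_congr_ae ?_
    filter_upwards [h2.coeFn_toLp] with x hx
    rw [hx]
  have := e1.trans (e3.symm.trans e2)
  simpa [hG] using this

theorem fourierL1_ae_eq_fourierL2 {u : E n → ℂ} (h1 : Integrable u volume)
    (h2 : MemLp u 2 volume) : fourierL1 u =ᵐ[volume] fourierL2 u := by
  have hq : Measure.QuasiMeasurePreserving (fun ξ : E n => (2 * Real.pi)⁻¹ • ξ) volume volume :=
    Measure.quasiMeasurePreserving_smul volume (by positivity)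
  filter_upwards [hq.ae (fourier_ae_eq h1 h2)] with ξ hξ
  rw [fourierL1_eq, fourierL2, dif_pos h2, hξ]

theorem fourierL1_sub {u v : E n → ℂ} (hu : Integrable u volume) (hv : Integrable v volume) :
    fourierL1 (u - v) = fourierL1 u - fourierL1 v := by
  have key : ∀ (w : E n → ℂ), Integrable w volume → ∀ ξ : E n, Integrable
      (fun x => w x * Complex.exp (-(Complex.I * (inner ℝ x ξ : ℝ)))) volume := by
    intro w hw ξ
    refine hw.mul_bdd (c := 1) (Continuous.aestronglyMeasurable (by fun_prop))
      (Filter.Eventually.of_forall fun x => ?_)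
    rw [← mul_neg, ← mul_comm (-_), ← Complex.ofReal_neg, Complex.norm_exp_ofReal_mul_I]
  ext ξ
  simp only [fourierL1, Pi.sub_apply, sub_mul]
  exact integral_sub (key u hu ξ) (key v hv ξ)

theorem fourierL2_sub {u v : E n → ℂ} (hu : MemLp u 2 volume) (hv : MemLp v 2 volume) :
    fourierL2 (u - v) =ᵐ[volume] fourierL2 u - fourierL2 v := by
  have hq : Measure.QuasiMeasurePreserving (fun ξ : E n => (2 * Real.pi)⁻¹ • ξ) volume volume :=
    Measure.quasiMeasurePreserving_smul volume (by positivity)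
  have e : (𝓕 ((hu.sub hv).toLp (u - v)) : Lp ℂ 2 (volume : Measure (E n)))
      = 𝓕 (hu.toLp u) - 𝓕 (hv.toLp v) := by
    rw [MemLp.toLp_sub]
    exact map_sub (Lp.fourierTransformₗᵢ (E n) ℂ) _ _
  filter_upwards [hq.ae (Lp.coeFn_sub (𝓕 (hu.toLp u) : Lp ℂ 2 (volume : Measure (E n)))
    (𝓕 (hv.toLp v)))] with ξ hξ
  rw [Pi.sub_apply, fourierL2, fourierL2, fourierL2, dif_pos hu, dif_pos hv, dif_pos (hu.sub hv),
    e, hξ, Pi.sub_apply]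

theorem memLp_large {f : E n → ℂ} {p : ℝ} (hp1 : 1 ≤ p)
    (hf : MemLp f (ENNReal.ofReal p) volume) :
    Integrable ({x | 1 < ‖f x‖}.indicator f) volume := by
  have hp0 : ENNReal.ofReal p ≠ 0 := by simp; linarith
  have h := hf.integrable_norm_rpow hp0 ENNReal.ofReal_ne_top
  rw [ENNReal.toReal_ofReal (by linarith)] at h
  have hs : NullMeasurableSet {x | 1 < ‖f x‖} volume :=
    nullMeasurableSet_lt aemeasurable_const hf.1.norm.aemeasurable
  refine h.mono (hf.1.indicator₀ hs) (Filter.Eventually.of_forall fun x => ?_)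
  rw [Real.norm_of_nonneg (by positivity)]
  by_cases hx : 1 < ‖f x‖
  · rw [Set.indicator_of_mem (by exact hx)]
    simpa using Real.rpow_le_rpow_of_exponent_le hx.le hp1
  · rw [Set.indicator_of_notMem (by exact hx)]
    simpa using by positivity

theorem memLp_small {f : E n → ℂ} {p : ℝ} (hp1 : 1 ≤ p) (hp2 : p ≤ 2)
    (hf : MemLp f (ENNReal.ofReal p) volume) :
    MemLp ({x | ‖f x‖ ≤ 1}.indicator f) 2 volume := by
  have hp0 : ENNReal.ofReal p ≠ 0 := by simp; linarith
  have h := hf.integrable_norm_rpow hp0 ENNReal.ofReal_ne_top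
  rw [ENNReal.toReal_ofReal (by linarith)] at h
  have hs : NullMeasurableSet {x | ‖f x‖ ≤ 1} volume :=
    nullMeasurableSet_le hf.1.norm.aemeasurable aemeasurable_const
  have hm := hf.1.indicator₀ hs
  rw [memLp_two_iff_integrable_sq_norm hm]
  refine h.mono (hm.norm.pow 2) (Filter.Eventually.of_forall fun x => ?_)
  rw [Real.norm_of_nonneg (by positivity), Real.norm_of_nonneg (by positivity)]
  by_cases hx : ‖f x‖ ≤ 1
  · rw [Set.indicator_of_mem (by exact hx), ← Real.rpow_natCast]
    exact Real.rpow_le_rpow_of_exponent_ge' (norm_nonneg _) hx (by linarith) (by exact_mod_cast hp2)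
  · rw [Set.indicator_of_notMem (by exact hx)]
    simpa using by positivity

/-- On `Lᵖ`, `1 ≤ p ≤ 2`, the transform may be computed from any decomposition `f = g + h` with
`g ∈ L¹` and `h ∈ L²`. -/
theorem fourierLp_eq_of_decomposition {f g h : E n → ℂ} {p : ℝ} (hp1 : 1 ≤ p) (hp2 : p ≤ 2)
    (hf : MemLp f (ENNReal.ofReal p) volume) (hg : Integrable g volume) (hh : MemLp h 2 volume)
    (hfgh : f =ᵐ[volume] g + h) : fourierLp f =ᵐ[volume] fourierL1 g + fourierL2 h := by
  have ha := memLp_large hp1 hf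
  have hb := memLp_small hp1 hp2 hf
  set a := {x | 1 < ‖f x‖}.indicator f with hadef
  set b := {x | ‖f x‖ ≤ 1}.indicator f with hbdef
  have hab : ∀ x, a x + b x = f x := by
    intro x
    by_cases hx : ‖f x‖ ≤ 1
    · simp [hadef, hbdef, hx, not_lt.2 hx]
    · simp [hadef, hbdef, hx, not_le.1 hx]
  have hd : a - g =ᵐ[volume] h - b := by
    filter_upwards [hfgh] with x hx
    have := hab x
    simp only [Pi.sub_apply, Pi.add_apply] at *
    linear_combination this + hx
  have h1 : Integrable (h - b) volume := (ha.sub hg).congr hd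
  have h2 : MemLp (h - b) 2 volume := hh.sub hb
  have e1 : fourierL1 (a - g) = fourierL1 (h - b) := by
    ext ξ
    refine integral_congr_ae ?_
    filter_upwards [hd] with x hx
    rw [hx]
  filter_upwards [fourierL1_ae_eq_fourierL2 h1 h2, fourierL2_sub hh hb] with ξ h3 h4
  have h5 := congrFun e1 ξ
  rw [fourierL1_sub ha hg] at h5
  simp only [Pi.sub_apply, Pi.add_apply] at h4 h5 ⊢
  change fourierL1 a ξ + fourierL2 b ξ = _
  linear_combination h5 + h3 + h4

/-- The Fourier inversion integral `(2π)⁻ⁿ ∫ g(ξ) e^{i x·ξ} dξ`. -/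
def inversionIntegral (g : E n → ℂ) (x : E n) : ℂ :=
  ((2 * Real.pi : ℂ) ^ n)⁻¹ * ∫ ξ, g ξ * Complex.exp (Complex.I * (inner ℝ x ξ : ℝ))

end FourierGrowth

end

namespace FourierGrowth

variable {n : ℕ}

/-! On the Fourier side `M_μ^t - 1` is multiplication by `μ̂(tξ) - 1`, and membership in `K_σ` keeps
`|1 - μ̂| ≥ c` outside the unit ball. Hence at frequencies `|ξ| ≥ 1/t` the transform of `f` is at
most `c⁻¹` times that of `M_μ^t f - f`, a function of `Lᵖ` norm `O(t^α)`.

To turn an `Lᵖ` norm into an `L¹` bound in frequency, `∫_{|ξ|<R} |ĝ| ≤ K ‖g‖_p R^{n/p}` is used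
(`exists_setLIntegral_ball_fourierLpTwoPi_le`). This is the consequence of Hausdorff–Young and
Hölder, but it follows from truncation alone: cut `g` at a height `l`, use `‖ĝ‖_∞ ≤ ‖g‖_1` on the
large values and Plancherel with Cauchy–Schwarz on the small ones, then optimise `l`.

With `t = 2^{-k}`, the annulus `2^k ≤ |ξ| < 2^{k+1}` contributes `O(2^{k(n/p - α)})` to `∫ |f̂|`.
Since `α > n/p` the sum over `k` is geometric, and the remaining ball is covered by the same `L¹`
bound applied to `f`. So `f̂ ∈ L¹`.

The multiplier identity and the inversion formula are both proved by duality: each side is locally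
integrable and is tested against smooth compactly supported functions through `∫ f φ̂ = ∫ f̂ φ`. -/

/-! ### Complex measures in polar form -/

/-- Polar decomposition of a complex measure, as a formula for integrals. -/
theorem exists_cintegral_eq (μ : ComplexMeasure (E n)) :
    ∃ h : E n → ℂ, Integrable h μ.variation ∧ (∀ᵐ y ∂μ.variation, ‖h y‖ = 1) ∧
      ∀ g : E n → ℂ, cintegral μ g = ∫ y, g y * h y ∂μ.variation := by
  set ν := μ.variation with hν
  have hac : μ ≪ᵥ ν.toENNRealVectorMeasure := VectorMeasure.absolutelyContinuous μ
  obtain ⟨hre, him⟩ := (ComplexMeasure.absolutelyContinuous_ennreal_iff _ _).1 hac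
  have hi : Integrable (μ.rnDeriv ν) ν := μ.integrable_rnDeriv ν
  have hd : ν.withDensityᵥ (μ.rnDeriv ν) = μ := by
    ext s hs
    rw [withDensityᵥ_apply hi hs]
    apply Complex.ext
    · rw [← RCLike.re_eq_complex_re, ← integral_re hi.integrableOn]
      have := congrArg (fun m => m s)
        (SignedMeasure.withDensityᵥ_rnDeriv_eq (ComplexMeasure.re μ) ν hre)
      simp only [withDensityᵥ_apply (SignedMeasure.integrable_rnDeriv _ _) hs] at this
      exact this
    · rw [← RCLike.im_eq_complex_im, ← integral_im hi.integrableOn]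
      have := congrArg (fun m => m s)
        (SignedMeasure.withDensityᵥ_rnDeriv_eq (ComplexMeasure.im μ) ν him)
      simp only [withDensityᵥ_apply (SignedMeasure.integrable_rnDeriv _ _) hs] at this
      exact this
  set h := μ.rnDeriv ν with hh
  -- The variation of `h dν` is `‖h‖ dν`. Here it is `ν` itself, and densities with respect to `ν`
  -- are unique almost everywhere.
  have hnorm : ∀ᵐ y ∂ν, ‖h y‖ = 1 := by
    have e := Measure.variation_withDensityᵥ hi
    rw [hd, ← hν] at e
    have e' : ν.withDensity (fun y => ‖h y‖ₑ) = ν.withDensity fun _ => 1 := by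
      rw [← e]
      exact withDensity_one.symm
    rw [withDensity_eq_iff hi.1.enorm aemeasurable_const hi.2.ne] at e'
    filter_upwards [e'] with y hy
    rw [← toReal_enorm, hy]; simp
  have hmul : ∀ g : E n → ℂ, Integrable g ν → Integrable (fun y => g y * h y) ν := by
    intro g hg
    exact hg.mul_bdd (c := 1) hi.1 (hnorm.mono fun y hy => hy.le)
  refine ⟨h, hi, hnorm, fun g => ?_⟩
  by_cases hg : Integrable g ν
  · refine hg.induction (P := fun g => cintegral μ g = ∫ y, g y * h y ∂ν) ?_ ?_ ?_ ?_
    · intro c s hs _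
      have e1 : cintegral μ (s.indicator fun _ => c) = c * μ s := by
        rw [cintegral, VectorMeasure.integral_indicator hs]
        simp [VectorMeasure.restrict_apply, hs]
      have e2 : ∀ y, s.indicator (fun _ => c) y * h y = s.indicator (fun y => c * h y) y := by
        intro y
        by_cases hy : y ∈ s <;> simp [hy]
      simp only [e1, e2]
      rw [integral_indicator hs, integral_const_mul, ← withDensityᵥ_apply hi hs, hd]
    · intro f g _ hf hg ef eg
      have e1 : cintegral μ (f + g) = cintegral μ f + cintegral μ g :=
        VectorMeasure.integral_add hf hg
      rw [e1, ef, eg, ← integral_add (hmul f hf) (hmul g hg)]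
      simp only [Pi.add_apply, add_mul]
    -- Both sides are continuous in the `L¹` norm; for the right side this is `‖h‖ = 1`.
    · refine isClosed_eq VectorMeasure.continuous_integral ?_
      refine continuous_iff_continuousAt.2 fun F => ?_
      rw [ContinuousAt, tendsto_iff_norm_sub_tendsto_zero]
      have hb : ∀ G : Lp ℂ 1 ν, ‖∫ y, G y * h y ∂ν - ∫ y, F y * h y ∂ν‖ ≤ ‖G - F‖ := by
        intro G
        have hG := L1.integrable_coeFn G
        have hF := L1.integrable_coeFn F
        rw [← integral_sub (hmul G hG) (hmul F hF), L1.norm_eq_integral_norm]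
        refine (norm_integral_le_integral_norm _).trans (le_of_eq (integral_congr_ae ?_))
        filter_upwards [hnorm, Lp.coeFn_sub G F] with y hy hs
        rw [hs, Pi.sub_apply, ← sub_mul, norm_mul, hy, mul_one]
      refine squeeze_zero (fun _ => norm_nonneg _) hb ?_
      exact (tendsto_iff_norm_sub_tendsto_zero.1 (Filter.tendsto_id (x := 𝓝 F)))
    · intro f g hfg _ ef
      have e1 : cintegral μ f = cintegral μ g := VectorMeasure.integral_congr_ae hfg
      rw [← e1, ef]
      refine integral_congr_ae ?_
      filter_upwards [hfg] with y hy
      rw [hy]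
  · rw [cintegral, VectorMeasure.integral_undef hg, integral_undef]
    intro h'
    -- Both integrals have the default value `0` once `g * h` is known not to be integrable. If it
    -- were, multiplying by the bounded factor `conj h` would return `g`, since `h * conj h = 1`.
    have hstar := h'.mul_bdd (c := 1) (g := fun y => (starRingEnd ℂ) (h y))
      (Complex.continuous_conj.comp_aestronglyMeasurable hi.1) (hnorm.mono fun y hy => by simp [hy])
    refine hg (hstar.congr ?_)
    filter_upwards [hnorm] with y hy
    rw [mul_assoc, Complex.mul_conj, Complex.normSq_eq_norm_sq, hy]
    simp

/-! ### The transform on `Lᵖ` and the multiplication formula -/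

/-- The transform `fourierLp` in Mathlib's normalization, with kernel `e^{-2π i x·ξ}`. -/
noncomputable def fourierLpTwoPi (f : E n → ℂ) (ξ : E n) : ℂ := fourierLp f ((2 * Real.pi) • ξ)

/-- The dilation by `2π` cancels the one in `fourierL1` and `fourierL2`. The freedom in the
decomposition is what later allows a truncation height adapted to the radius of a ball. -/
theorem fourierLpTwoPi_ae_eq {f g h : E n → ℂ} {p : ℝ} (hp1 : 1 ≤ p) (hp2 : p ≤ 2)
    (hf : MemLp f (ENNReal.ofReal p) volume) (hg : Integrable g volume) (hh : MemLp h 2 volume)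
    (hfgh : f =ᵐ[volume] g + h) :
    fourierLpTwoPi f =ᵐ[volume]
      fun ξ => 𝓕 g ξ + (𝓕 (hh.toLp h) : Lp ℂ 2 (volume : Measure (E n))) ξ := by
  have hq : Measure.QuasiMeasurePreserving (fun ξ : E n => (2 * Real.pi) • ξ) volume volume :=
    Measure.quasiMeasurePreserving_smul volume (by positivity)
  filter_upwards [hq.ae (fourierLp_eq_of_decomposition hp1 hp2 hf hg hh hfgh)] with ξ hξ
  rw [fourierLpTwoPi, hξ, Pi.add_apply, fourierL1_eq, fourierL2, dif_pos hh, smul_smul,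
    inv_mul_cancel₀ (by positivity), one_smul]

/-- Truncation at height `l` splits a function into its large and small values. -/
theorem indicator_large_add_small (f : E n → ℂ) (l : ℝ) :
    f = {x | l < ‖f x‖}.indicator f + {x | ‖f x‖ ≤ l}.indicator f := by
  ext x
  by_cases hx : ‖f x‖ ≤ l
  · simp [hx, not_lt.2 hx]
  · simp [hx, not_le.1 hx]

theorem integrable_mul_schwartz {f : E n → ℂ} {p : ℝ} (hp1 : 1 ≤ p)
    (hf : MemLp f (ENNReal.ofReal p) volume) (φ : SchwartzMap (E n) ℂ) :
    Integrable (fun x => f x * φ x) volume := by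
  have hp : 1 ≤ ENNReal.ofReal p := by simpa using hp1
  have := ENNReal.HolderConjugate.conjExponent hp
  exact hf.integrable_mul (φ.memLp (ENNReal.ofReal p).conjExponent)

theorem integral_mul_fourier_eq_integrable {g : E n → ℂ} (hg : Integrable g volume)
    (φ : SchwartzMap (E n) ℂ) :
    Integrable (fun ξ => 𝓕 g ξ * φ ξ) volume ∧ ∫ x, g x * 𝓕 φ x = ∫ ξ, 𝓕 g ξ * φ ξ := by
  have hc : Continuous (𝓕 g) :=
    VectorFourier.fourierIntegral_continuous Real.continuous_fourierChar
      (innerSL ℝ).continuous₂ hg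
  constructor
  · refine φ.integrable.bdd_mul (c := ∫ x, ‖g x‖) hc.aestronglyMeasurable
      (Filter.Eventually.of_forall fun ξ => ?_)
    exact VectorFourier.norm_fourierIntegral_le_integral_norm _ _ _ _ _
  · have := VectorFourier.integral_fourierIntegral_smul_eq_flip (L := innerₗ (E n)) (μ := volume)
      (ν := volume) Real.continuous_fourierChar continuous_inner hg φ.integrable
    simp only [flip_innerₗ, smul_eq_mul] at this
    rw [SchwartzMap.fourier_coe]
    exact this.symm

theorem integral_mul_fourier_eq_memLp_two {h : E n → ℂ} (hh : MemLp h 2 volume)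
    (φ : SchwartzMap (E n) ℂ) :
    Integrable (fun ξ => (𝓕 (hh.toLp h) : Lp ℂ 2 (volume : Measure (E n))) ξ * φ ξ) volume ∧
      ∫ x, h x * 𝓕 φ x = ∫ ξ, (𝓕 (hh.toLp h) : Lp ℂ 2 (volume : Measure (E n))) ξ * φ ξ := by
  constructor
  · exact (Lp.memLp (𝓕 (hh.toLp h) : Lp ℂ 2 (volume : Measure (E n)))).integrable_mul
      (φ.memLp 2)
  · have e2 := congrArg (fun T => T φ) (Lp.fourier_toTemperedDistribution_eq (hh.toLp h))
    simp only [TemperedDistribution.fourier_apply, Lp.toTemperedDistribution_apply,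
      smul_eq_mul] at e2
    have e3 : ∫ x, 𝓕 φ x * (hh.toLp h : E n → ℂ) x = ∫ x, h x * 𝓕 φ x := by
      refine integral_congr_ae ?_
      filter_upwards [hh.coeFn_toLp] with x hx
      rw [hx, mul_comm]
    rw [← e3, e2]
    simp only [mul_comm]

/-- The multiplication formula on `Lᵖ`, `1 ≤ p ≤ 2`. -/
theorem integral_mul_fourier_eq {f : E n → ℂ} {p : ℝ} (hp1 : 1 ≤ p) (hp2 : p ≤ 2)
    (hf : MemLp f (ENNReal.ofReal p) volume) (φ : SchwartzMap (E n) ℂ) :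
    ∫ x, f x * 𝓕 φ x = ∫ ξ, fourierLpTwoPi f ξ * φ ξ := by
  have ha := memLp_large hp1 hf
  have hb := memLp_small hp1 hp2 hf
  have hab := indicator_large_add_small f 1
  obtain ⟨i1, e1⟩ := integral_mul_fourier_eq_integrable ha φ
  obtain ⟨i2, e2⟩ := integral_mul_fourier_eq_memLp_two hb φ
  have e3 : ∫ ξ, fourierLpTwoPi f ξ * φ ξ = ∫ ξ, (𝓕 ({x | 1 < ‖f x‖}.indicator f) ξ * φ ξ
      + (𝓕 (hb.toLp _) : Lp ℂ 2 (volume : Measure (E n))) ξ * φ ξ) := by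
    refine integral_congr_ae ?_
    filter_upwards [fourierLpTwoPi_ae_eq hp1 hp2 hf ha hb (Filter.EventuallyEq.of_eq hab)]
      with ξ hξ
    rw [hξ, add_mul]
  have i3 : Integrable (fun x => {x | 1 < ‖f x‖}.indicator f x * 𝓕 φ x) volume :=
    integrable_mul_schwartz (p := 1) le_rfl (by simpa [memLp_one_iff_integrable] using ha) (𝓕 φ)
  have i4 : Integrable (fun x => {x | ‖f x‖ ≤ 1}.indicator f x * 𝓕 φ x) volume :=
    integrable_mul_schwartz (p := 2) one_le_two (by simpa using hb) (𝓕 φ)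
  rw [e3, integral_add i1 i2, ← e1, ← e2, ← integral_add i3 i4]
  refine integral_congr_ae (Filter.Eventually.of_forall fun x => ?_)
  have := congrFun hab x
  simp only [Pi.add_apply] at this
  simp only [← add_mul, ← this]

/-! ### `L¹` bounds for the transform on balls -/

theorem integral_norm_rpow_le {g : E n → ℂ} {p N : ℝ} (hp1 : 1 ≤ p) (hN : 0 < N)
    (hg : MemLp g (ENNReal.ofReal p) volume)
    (hgN : eLpNorm g (ENNReal.ofReal p) volume ≤ ENNReal.ofReal N) :
    ∫ x, ‖g x‖ ^ p ≤ N ^ p := by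
  have hp : 0 < p := by linarith
  have h0 : ENNReal.ofReal p ≠ 0 := by simpa using hp
  have e := hg.eLpNorm_eq_integral_rpow_norm h0 ENNReal.ofReal_ne_top
  rw [ENNReal.toReal_ofReal hp.le] at e
  rw [e, ENNReal.ofReal_le_ofReal_iff hN.le] at hgN
  have hI : 0 ≤ ∫ x, ‖g x‖ ^ p := integral_nonneg fun x => by positivity
  calc ∫ x, ‖g x‖ ^ p = ((∫ x, ‖g x‖ ^ p) ^ p⁻¹) ^ p := (Real.rpow_inv_rpow hI hp.ne').symm
    _ ≤ N ^ p := by gcongr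

/-- The values above height `l` of an `Lᵖ` function form an `L¹` function. -/
theorem integrable_large {g : E n → ℂ} {p l N : ℝ} (hp1 : 1 ≤ p) (hl : 0 < l) (hN : 0 < N)
    (hg : MemLp g (ENNReal.ofReal p) volume)
    (hgN : eLpNorm g (ENNReal.ofReal p) volume ≤ ENNReal.ofReal N) :
    Integrable ({x | l < ‖g x‖}.indicator g) volume ∧
      ∫ x, ‖{x | l < ‖g x‖}.indicator g x‖ ≤ l ^ (1 - p) * N ^ p := by
  have h := hg.integrable_norm_rpow (by simp; linarith) ENNReal.ofReal_ne_top
  rw [ENNReal.toReal_ofReal (by linarith)] at h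
  have hs : NullMeasurableSet {x | l < ‖g x‖} volume :=
    nullMeasurableSet_lt aemeasurable_const hg.1.norm.aemeasurable
  have hb : ∀ x, ‖{x | l < ‖g x‖}.indicator g x‖ ≤ l ^ (1 - p) * ‖g x‖ ^ p := by
    intro x
    by_cases hx : l < ‖g x‖
    · rw [Set.indicator_of_mem (by exact hx)]
      have hg0 : 0 < ‖g x‖ := hl.trans hx
      calc ‖g x‖ = ‖g x‖ ^ (1 - p) * ‖g x‖ ^ p := by
            rw [← Real.rpow_add hg0]; simp
        _ ≤ l ^ (1 - p) * ‖g x‖ ^ p := by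
            refine mul_le_mul_of_nonneg_right ?_ (by positivity)
            -- The exponent `1 - p` is nonpositive, so the power decreases from its value at `l`.
            exact Real.rpow_le_rpow_of_nonpos hl hx.le (by linarith)
    · rw [Set.indicator_of_notMem (by exact hx), norm_zero]
      positivity
  have hi : Integrable ({x | l < ‖g x‖}.indicator g) volume :=
    (h.const_mul (l ^ (1 - p))).mono' (hg.1.indicator₀ hs) (Filter.Eventually.of_forall hb)
  refine ⟨hi, (integral_mono hi.norm (h.const_mul _) hb).trans ?_⟩
  rw [integral_const_mul]
  gcongr
  exact integral_norm_rpow_le hp1 hN hg hgN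

/-- The values below height `l` of an `Lᵖ` function, `p ≤ 2`, form an `L²` function. -/
theorem memLp_two_small {g : E n → ℂ} {p l N : ℝ} (hp1 : 1 ≤ p) (hp2 : p ≤ 2) (hl : 0 < l)
    (hN : 0 < N) (hg : MemLp g (ENNReal.ofReal p) volume)
    (hgN : eLpNorm g (ENNReal.ofReal p) volume ≤ ENNReal.ofReal N) :
    MemLp ({x | ‖g x‖ ≤ l}.indicator g) 2 volume ∧
      eLpNorm ({x | ‖g x‖ ≤ l}.indicator g) 2 volume ≤
        ENNReal.ofReal ((l ^ (2 - p) * N ^ p) ^ (2⁻¹ : ℝ)) := by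
  have h := hg.integrable_norm_rpow (by simp; linarith) ENNReal.ofReal_ne_top
  rw [ENNReal.toReal_ofReal (by linarith)] at h
  have hs : NullMeasurableSet {x | ‖g x‖ ≤ l} volume :=
    nullMeasurableSet_le hg.1.norm.aemeasurable aemeasurable_const
  have hm := hg.1.indicator₀ hs
  have hb : ∀ x, ‖{x | ‖g x‖ ≤ l}.indicator g x‖ ^ (2 : ℝ) ≤ l ^ (2 - p) * ‖g x‖ ^ p := by
    intro x
    by_cases hx : ‖g x‖ ≤ l
    · rw [Set.indicator_of_mem (by exact hx)]
      rcases (norm_nonneg (g x)).eq_or_lt with h0 | h0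
      · rw [← h0, Real.zero_rpow two_ne_zero]
        positivity
      calc ‖g x‖ ^ (2 : ℝ) = ‖g x‖ ^ (2 - p) * ‖g x‖ ^ p := by
            rw [← Real.rpow_add h0]; simp
        _ ≤ l ^ (2 - p) * ‖g x‖ ^ p := by
            gcongr
    · rw [Set.indicator_of_notMem (by exact hx), norm_zero, Real.zero_rpow two_ne_zero]
      positivity
  have hi : Integrable (fun x => ‖{x | ‖g x‖ ≤ l}.indicator g x‖ ^ (2 : ℝ)) volume := by
    refine (h.const_mul (l ^ (2 - p))).mono' (hm.norm.aemeasurable.pow_const _).aestronglyMeasurable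
      (Filter.Eventually.of_forall fun x => ?_)
    rw [Real.norm_of_nonneg (by positivity)]
    exact hb x
  have hM : MemLp ({x | ‖g x‖ ≤ l}.indicator g) 2 volume := by
    rw [memLp_two_iff_integrable_sq_norm hm]
    simpa using hi
  refine ⟨hM, ?_⟩
  rw [hM.eLpNorm_eq_integral_rpow_norm two_ne_zero ENNReal.ofNat_ne_top, ENNReal.toReal_ofNat]
  gcongr
  refine (integral_mono hi (h.const_mul _) hb).trans ?_
  rw [integral_const_mul]
  gcongr
  exact integral_norm_rpow_le hp1 hN hg hgN

theorem setLIntegral_enorm_fourier_le {g : E n → ℂ} (s : Set (E n)) :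
    ∫⁻ ξ in s, ‖𝓕 g ξ‖ₑ ≤ ENNReal.ofReal (∫ x, ‖g x‖) * volume s := by
  rw [← setLIntegral_const]
  refine lintegral_mono fun ξ => ?_
  rw [← ofReal_norm]
  exact ENNReal.ofReal_le_ofReal (VectorFourier.norm_fourierIntegral_le_integral_norm _ _ _ _ _)

/-- Cauchy–Schwarz against the constant `1` on `s`. -/
theorem setLIntegral_enorm_le_eLpNorm_two {h : E n → ℂ} (hh : AEStronglyMeasurable h volume)
    (s : Set (E n)) :
    ∫⁻ ξ in s, ‖h ξ‖ₑ ≤ eLpNorm h 2 volume * volume s ^ (2⁻¹ : ℝ) := by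
  have := eLpNorm_le_eLpNorm_mul_rpow_measure_univ (p := 1) (q := 2) one_le_two
    (hh.restrict (s := s))
  rw [eLpNorm_one_eq_lintegral_enorm, Measure.restrict_apply_univ] at this
  refine this.trans ?_
  have e : (1 / (1 : ℝ≥0∞).toReal - 1 / (2 : ℝ≥0∞).toReal) = 2⁻¹ := by norm_num
  rw [e]
  gcongr
  exact Measure.restrict_le_self

theorem aestronglyMeasurable_fourierLpTwoPi {f : E n → ℂ} {p : ℝ} (hp1 : 1 ≤ p) (hp2 : p ≤ 2)
    (hf : MemLp f (ENNReal.ofReal p) volume) :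
    AEStronglyMeasurable (fourierLpTwoPi f) volume := by
  have ha := memLp_large hp1 hf
  have hb := memLp_small hp1 hp2 hf
  have hc : Continuous (𝓕 ({x | 1 < ‖f x‖}.indicator f)) :=
    VectorFourier.fourierIntegral_continuous Real.continuous_fourierChar
      (innerSL ℝ).continuous₂ ha
  exact (hc.aestronglyMeasurable.add (Lp.aestronglyMeasurable _)).congr
    (fourierLpTwoPi_ae_eq hp1 hp2 hf ha hb
      (Filter.EventuallyEq.of_eq (indicator_large_add_small f 1))).symm

/-- The transform of an `Lᵖ` function has integral `O(R^{n/p})` over the ball of radius `R`. -/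
theorem exists_setLIntegral_ball_fourierLpTwoPi_le (hn : n ≠ 0) {p : ℝ} (hp1 : 1 ≤ p)
    (hp2 : p ≤ 2) :
    ∃ K : ℝ, 0 ≤ K ∧ ∀ (g : E n → ℂ) (N R : ℝ), 0 < N → 0 < R →
      MemLp g (ENNReal.ofReal p) volume →
      eLpNorm g (ENNReal.ofReal p) volume ≤ ENNReal.ofReal N →
      ∫⁻ ξ in Metric.ball 0 R, ‖fourierLpTwoPi g ξ‖ₑ ≤
        ENNReal.ofReal (K * N * R ^ ((n : ℝ) / p)) := by
  have : NeZero n := ⟨hn⟩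
  set v : ℝ := (volume (Metric.ball (0 : E n) 1)).toReal with hv
  have hv0 : 0 ≤ v := ENNReal.toReal_nonneg
  refine ⟨v + v ^ (2⁻¹ : ℝ), by positivity, fun g N R hN hR hg hgN => ?_⟩
  have hp : 0 < p := by linarith
  -- This height balances the two pieces. It gives `l^p = N^p R^n`, so the `L¹` part contributes
  -- `l^{1-p} N^p · v R^n = v l` and the `L²` part `(l^{2-p} N^p · v R^n)^{1/2} = v^{1/2} l`.
  set l := N * R ^ ((n : ℝ) / p) with hl
  have hl0 : 0 < l := by positivity
  obtain ⟨ha, hA⟩ := integrable_large hp1 hl0 hN hg hgN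
  obtain ⟨hb, hB⟩ := memLp_two_small hp1 hp2 hl0 hN hg hgN
  set a := {x | l < ‖g x‖}.indicator g
  set b := {x | ‖g x‖ ≤ l}.indicator g
  have hae := fourierLpTwoPi_ae_eq hp1 hp2 hg ha hb
    (Filter.EventuallyEq.of_eq (indicator_large_add_small g l))
  set F : E n → ℂ := ⇑(𝓕 (hb.toLp b) : Lp ℂ 2 (volume : Measure (E n)))
  have hF : eLpNorm F 2 volume = eLpNorm b 2 volume := by
    have := Lp.norm_fourier_eq (hb.toLp b)
    rw [Lp.norm_def, Lp.norm_def, ENNReal.toReal_eq_toReal_iff' (Lp.eLpNorm_ne_top _)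
      (Lp.eLpNorm_ne_top _)] at this
    rw [this]
    exact eLpNorm_congr_ae hb.coeFn_toLp
  have hFm : AEStronglyMeasurable F volume := Lp.aestronglyMeasurable _
  have hc : Continuous (𝓕 a) :=
    VectorFourier.fourierIntegral_continuous Real.continuous_fourierChar
      (innerSL ℝ).continuous₂ ha
  have hvol : volume (Metric.ball (0 : E n) R) = ENNReal.ofReal (R ^ (n : ℝ) * v) := by
    rw [Measure.addHaar_ball _ _ hR.le, hv, ENNReal.ofReal_mul (by positivity),
      ENNReal.ofReal_toReal measure_ball_lt_top.ne, finrank_euclideanSpace_fin, Real.rpow_natCast]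
  have hRn : 0 < R ^ (n : ℝ) := by positivity
  have el : l ^ p = N ^ p * R ^ (n : ℝ) := by
    rw [hl, Real.mul_rpow hN.le (by positivity), ← Real.rpow_mul hR.le, div_mul_cancel₀ _ hp.ne']
  have hNp : N ^ p = l ^ p * (R ^ (n : ℝ))⁻¹ := by
    rw [el]; field_simp
  have e1 : l ^ (1 - p) * N ^ p * (R ^ (n : ℝ) * v) = v * l := by
    have : l ^ (1 - p) * l ^ p = l := by rw [← Real.rpow_add hl0]; simp
    rw [hNp]
    calc _ = (l ^ (1 - p) * l ^ p) * ((R ^ (n : ℝ))⁻¹ * R ^ (n : ℝ)) * v := by ring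
      _ = _ := by rw [this, inv_mul_cancel₀ hRn.ne']; ring
  have e2 : (l ^ (2 - p) * N ^ p) ^ (2⁻¹ : ℝ) * (R ^ (n : ℝ) * v) ^ (2⁻¹ : ℝ)
      = v ^ (2⁻¹ : ℝ) * l := by
    have h2 : l ^ (2 - p) * l ^ p = l ^ (2 : ℝ) := by rw [← Real.rpow_add hl0]; simp
    rw [← Real.mul_rpow (by positivity) (by positivity), hNp]
    have : l ^ (2 - p) * (l ^ p * (R ^ (n : ℝ))⁻¹) * (R ^ (n : ℝ) * v) = v * l ^ (2 : ℝ) := by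
      calc _ = (l ^ (2 - p) * l ^ p) * ((R ^ (n : ℝ))⁻¹ * R ^ (n : ℝ)) * v := by ring
        _ = _ := by rw [h2, inv_mul_cancel₀ hRn.ne']; ring
    rw [this, Real.mul_rpow hv0 (by positivity), Real.rpow_rpow_inv hl0.le two_ne_zero]
  calc ∫⁻ ξ in Metric.ball 0 R, ‖fourierLpTwoPi g ξ‖ₑ
      ≤ ∫⁻ ξ in Metric.ball 0 R, (‖𝓕 a ξ‖ₑ + ‖F ξ‖ₑ) := by
        refine lintegral_mono_ae (ae_restrict_of_ae ?_)
        filter_upwards [hae] with ξ hξ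
        rw [hξ]
        exact enorm_add_le _ _
    _ = (∫⁻ ξ in Metric.ball 0 R, ‖𝓕 a ξ‖ₑ) + ∫⁻ ξ in Metric.ball 0 R, ‖F ξ‖ₑ :=
        lintegral_add_left' hc.aestronglyMeasurable.enorm _
    _ ≤ ENNReal.ofReal (∫ x, ‖a x‖) * volume (Metric.ball (0 : E n) R) +
        eLpNorm F 2 volume * volume (Metric.ball (0 : E n) R) ^ (2⁻¹ : ℝ) :=
        add_le_add (setLIntegral_enorm_fourier_le _) (setLIntegral_enorm_le_eLpNorm_two hFm _)
    _ ≤ ENNReal.ofReal (l ^ (1 - p) * N ^ p) * ENNReal.ofReal (R ^ (n : ℝ) * v) +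
        ENNReal.ofReal ((l ^ (2 - p) * N ^ p) ^ (2⁻¹ : ℝ)) *
          ENNReal.ofReal (R ^ (n : ℝ) * v) ^ (2⁻¹ : ℝ) := by
        rw [hvol, hF]
        gcongr
    _ = ENNReal.ofReal ((v + v ^ (2⁻¹ : ℝ)) * N * R ^ ((n : ℝ) / p)) := by
        rw [ENNReal.ofReal_rpow_of_nonneg (by positivity) (by norm_num),
          ← ENNReal.ofReal_mul (by positivity), ← ENNReal.ofReal_mul (by positivity), e1, e2,
          ← ENNReal.ofReal_add (by positivity) (by positivity), hl]
        congr 1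
        ring

/-- This is what makes the transform determined by its integrals against test functions. -/
theorem locallyIntegrable_fourierLpTwoPi (hn : n ≠ 0) {f : E n → ℂ} {p : ℝ} (hp1 : 1 ≤ p)
    (hp2 : p ≤ 2) (hf : MemLp f (ENNReal.ofReal p) volume) :
    LocallyIntegrable (fourierLpTwoPi f) volume := by
  obtain ⟨K, -, hK⟩ := exists_setLIntegral_ball_fourierLpTwoPi_le hn hp1 hp2
  have hN : eLpNorm f (ENNReal.ofReal p) volume ≤
      ENNReal.ofReal ((eLpNorm f (ENNReal.ofReal p) volume).toReal + 1) := by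
    rw [ENNReal.ofReal_add ENNReal.toReal_nonneg zero_le_one, ENNReal.ofReal_toReal hf.2.ne]
    exact le_self_add
  intro x
  refine ⟨Metric.ball 0 (‖x‖ + 1), Metric.isOpen_ball.mem_nhds (by simp), ?_, ?_⟩
  · exact (aestronglyMeasurable_fourierLpTwoPi hp1 hp2 hf).restrict
  · exact (hK f _ _ (by positivity) (by positivity) hf hN).trans_lt ENNReal.ofReal_lt_top

/-! ### The averaging operator on the Fourier side -/

/-- For each fixed `y` the map `x ↦ x - t y` preserves Lebesgue measure, so null sets pull back to
null sets of the product, whatever the measure in `y`. -/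
theorem aestronglyMeasurable_comp_sub_smul {f : E n → ℂ} (hf : AEStronglyMeasurable f volume)
    (ν : Measure (E n)) [SFinite ν] (t : ℝ) :
    AEStronglyMeasurable (fun z : E n × E n => f (z.1 - t • z.2)) (volume.prod ν) := by
  refine hf.comp_quasiMeasurePreserving (f := fun z : E n × E n => z.1 - t • z.2)
    (QuasiMeasurePreserving.prod_of_left (by fun_prop)
      (Filter.Eventually.of_forall fun y => ?_))
  exact (measurePreserving_sub_right (volume : Measure (E n)) (t • y)).quasiMeasurePreserving

theorem aestronglyMeasurable_averageOp {f : E n → ℂ} (hf : AEStronglyMeasurable f volume)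
    (μ : ComplexMeasure (E n)) (t : ℝ) : AEStronglyMeasurable (averageOp μ t f) volume := by
  obtain ⟨h, hi, -, hμ⟩ := exists_cintegral_eq μ
  have e : averageOp μ t f = fun x => ∫ y, f (x - t • y) * h y ∂μ.variation := by
    ext x
    exact hμ _
  rw [e]
  exact ((aestronglyMeasurable_comp_sub_smul hf μ.variation t).mul hi.1.comp_snd).integral_prod_right'

/-- Translates of an `Lᵖ` function pair uniformly with a fixed Schwartz function. -/
theorem exists_integral_norm_translate_mul_le {f : E n → ℂ} {p : ℝ} (hp1 : 1 ≤ p)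
    (hf : MemLp f (ENNReal.ofReal p) volume) (ψ : SchwartzMap (E n) ℂ) :
    ∃ B : ℝ, ∀ z : E n, Integrable (fun x => f (x - z) * ψ x) volume ∧
      ∫ x, ‖f (x - z) * ψ x‖ ≤ B := by
  have hp : 1 ≤ ENNReal.ofReal p := by simpa using hp1
  obtain ⟨q, hq⟩ : ∃ q, (ENNReal.ofReal p).HolderConjugate q :=
    ⟨_, ENNReal.HolderConjugate.conjExponent hp⟩
  have hψ := ψ.memLp q (volume : Measure (E n))
  refine ⟨(eLpNorm f (ENNReal.ofReal p) volume *
    eLpNorm ψ q volume).toReal, fun z => ?_⟩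
  have hz : MemLp (fun x => f (x - z)) (ENNReal.ofReal p) volume :=
    hf.comp_measurePreserving (measurePreserving_sub_right volume z)
  have hzn : eLpNorm (fun x => f (x - z)) (ENNReal.ofReal p) volume
      = eLpNorm f (ENNReal.ofReal p) volume :=
    eLpNorm_comp_measurePreserving hf.1 (measurePreserving_sub_right volume z)
  have hi : Integrable (fun x => f (x - z) * ψ x) volume := hz.integrable_mul hψ
  refine ⟨hi, ?_⟩
  rw [integral_norm_eq_lintegral_enorm hi.1, ← eLpNorm_one_eq_lintegral_enorm]
  refine ENNReal.toReal_mono (ENNReal.mul_ne_top hf.2.ne hψ.2.ne) ?_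
  rw [← hzn]
  exact eLpNorm_smul_le_mul_eLpNorm (φ := fun x => f (x - z)) (f := ψ) hψ.1 hz.1

theorem norm_exp_neg_I_mul_inner (y ξ : E n) :
    ‖Complex.exp (-(Complex.I * (inner ℝ y ξ : ℝ)))‖ = 1 := by
  rw [← mul_neg, ← mul_comm (-_), ← Complex.ofReal_neg, Complex.norm_exp_ofReal_mul_I]

/-- Translating the transform of a test function amounts to modulating the test function. -/
theorem integral_mul_fourier_translate_eq {f : E n → ℂ} {p : ℝ} (hp1 : 1 ≤ p) (hp2 : p ≤ 2)
    (hf : MemLp f (ENNReal.ofReal p) volume) (φ : SchwartzMap (E n) ℂ)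
    (hφ : HasCompactSupport φ) (t : ℝ) (y : E n) :
    ∫ x, f (x - t • y) * 𝓕 φ x = ∫ ξ, fourierLpTwoPi f ξ *
      (Complex.exp (-(Complex.I * (inner ℝ y ((2 * Real.pi * t) • ξ) : ℝ))) * φ ξ) := by
  let m : E n → ℂ := fun ξ =>
    Complex.exp (-(Complex.I * (inner ℝ y ((2 * Real.pi * t) • ξ) : ℝ))) * φ ξ
  -- The modulated function is again smooth with compact support, hence an admissible function in
  -- the multiplication formula.
  have hm : ContDiff ℝ (⊤ : ℕ∞) m := by
    refine ContDiff.mul ?_ (φ.smooth ⊤)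
    refine Complex.contDiff_exp.comp (contDiff_const.mul ?_).neg
    exact Complex.ofRealCLM.contDiff.comp
      ((innerSL ℝ y).contDiff.comp (contDiff_const_smul (2 * Real.pi * t)))
  have hmc : HasCompactSupport m := hφ.mul_left
  let M : SchwartzMap (E n) ℂ := hmc.toSchwartzMap hm
  have e := integral_mul_fourier_eq hp1 hp2 hf M
  have hM : ∀ x, M x = m x := fun x => rfl
  simp only [hM] at e
  refine Eq.trans ?_ e
  rw [← integral_sub_right_eq_self (fun x => f x * 𝓕 M x) (t • y)]
  refine integral_congr_ae (Filter.Eventually.of_forall fun x => ?_)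
  simp only [SchwartzMap.fourier_coe]
  congr 1
  rw [Real.fourier_eq', Real.fourier_eq']
  refine integral_congr_ae (Filter.Eventually.of_forall fun ξ => ?_)
  simp only [hM, m, smul_eq_mul, ← mul_assoc, ← Complex.exp_add]
  congr 2
  rw [inner_sub_right, inner_smul_right, inner_smul_right, real_inner_comm y ξ]
  push_cast
  ring

/-- `∫ (M_μ^t f) φ̂ = ∫ μ̂(2πt·) f̂ φ` for test functions `φ`. -/
theorem integral_averageOp_mul_fourier_eq (hn : n ≠ 0) {f : E n → ℂ} {p : ℝ} (hp1 : 1 ≤ p)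
    (hp2 : p ≤ 2) (hf : MemLp f (ENNReal.ofReal p) volume) (μ : ComplexMeasure (E n)) (t : ℝ)
    (φ : SchwartzMap (E n) ℂ) (hφ : HasCompactSupport φ) :
    Integrable (fun x => averageOp μ t f x * 𝓕 φ x) volume ∧
    ∫ x, averageOp μ t f x * 𝓕 φ x =
      ∫ ξ, measureFourier μ ((2 * Real.pi * t) • ξ) * fourierLpTwoPi f ξ * φ ξ := by
  obtain ⟨h, hi, hnorm, hμ⟩ := exists_cintegral_eq μ
  set ν := μ.variation
  obtain ⟨B, hB⟩ := exists_integral_norm_translate_mul_le hp1 hf (𝓕 φ)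
  set ψ : E n → ℂ := ⇑(𝓕 φ : SchwartzMap (E n) ℂ)
  have hψc : Continuous ψ := (𝓕 φ : SchwartzMap (E n) ℂ).continuous
  have hΦm : AEStronglyMeasurable (fun z : E n × E n => f (z.1 - t • z.2) * h z.2 * ψ z.1)
      (volume.prod ν) :=
    ((aestronglyMeasurable_comp_sub_smul hf.1 ν t).mul hi.1.comp_snd).mul
      (hψc.comp continuous_fst).aestronglyMeasurable
  have hΦ : Integrable (fun z : E n × E n => f (z.1 - t • z.2) * h z.2 * ψ z.1)
      (volume.prod ν) := by
    rw [integrable_prod_iff' hΦm]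
    constructor
    · refine Filter.Eventually.of_forall fun y => ?_
      refine ((hB (t • y)).1.mul_const (h y)).congr (Filter.Eventually.of_forall fun x => ?_)
      simp only
      ring
    -- The inner integral is bounded by `B` uniformly in `y`, and `ν` is finite; this justifies
    -- Fubini.
    · refine Integrable.of_bound (C := B) hΦm.norm.prod_swap.integral_prod_right' ?_
      filter_upwards [hnorm] with y hy
      rw [Real.norm_of_nonneg (integral_nonneg fun _ => norm_nonneg _)]
      refine le_trans (le_of_eq ?_) (hB (t • y)).2
      refine integral_congr_ae (Filter.Eventually.of_forall fun x => ?_)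
      simp only [norm_mul, hy, mul_one]
  have eM : ∀ x, averageOp μ t f x * ψ x = ∫ y, f (x - t • y) * h y * ψ x ∂ν := by
    intro x
    rw [integral_mul_const]
    congr 1
    exact hμ _
  set G := fourierLpTwoPi f
  have hGφ : Integrable (fun ξ => G ξ * φ ξ) volume := by
    have := (locallyIntegrable_fourierLpTwoPi hn hp1 hp2 hf).integrable_smul_left_of_hasCompactSupport
      φ.continuous hφ
    simpa only [smul_eq_mul, mul_comm] using this
  let e : E n → E n → ℂ := fun y ξ =>
    Complex.exp (-(Complex.I * (inner ℝ y ((2 * Real.pi * t) • ξ) : ℝ)))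
  have hP : Integrable (fun z : E n × E n => h z.1 * (G z.2 * φ z.2) * e z.1 z.2)
      (ν.prod volume) := by
    refine (hi.mul_prod hGφ).mul_bdd (c := 1) (Continuous.aestronglyMeasurable ?_)
      (Filter.Eventually.of_forall fun z => (norm_exp_neg_I_mul_inner _ _).le)
    simp only [e]
    fun_prop
  refine ⟨by simpa only [eM] using hΦ.integral_prod_left, ?_⟩
  calc ∫ x, averageOp μ t f x * ψ x
      = ∫ x, ∫ y, f (x - t • y) * h y * ψ x ∂ν := by simp only [eM]
    _ = ∫ y, (∫ x, f (x - t • y) * h y * ψ x) ∂ν := integral_integral_swap hΦ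
    _ = ∫ y, (∫ ξ, h y * (G ξ * φ ξ) * e y ξ) ∂ν := by
        refine integral_congr_ae (Filter.Eventually.of_forall fun y => ?_)
        have := integral_mul_fourier_translate_eq hp1 hp2 hf φ hφ t y
        calc ∫ x, f (x - t • y) * h y * ψ x
            = h y * ∫ x, f (x - t • y) * ψ x := by
              rw [← integral_const_mul]
              exact integral_congr_ae (Filter.Eventually.of_forall fun x => by simp only; ring)
          _ = h y * ∫ ξ, G ξ * (e y ξ * φ ξ) := by rw [← this]
          _ = _ := by
              rw [← integral_const_mul]
              exact integral_congr_ae (Filter.Eventually.of_forall fun x => by simp only; ring)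
    _ = ∫ ξ, ∫ y, h y * (G ξ * φ ξ) * e y ξ ∂ν := integral_integral_swap hP
    _ = _ := by
        refine integral_congr_ae (Filter.Eventually.of_forall fun ξ => ?_)
        simp only [measureFourier, hμ]
        rw [mul_assoc, ← integral_mul_const]
        exact integral_congr_ae (Filter.Eventually.of_forall fun y => by simp only [e]; ring)

/-- Continuity ensures that multiplication by `μ̂` preserves local integrability. -/
theorem continuous_measureFourier (μ : ComplexMeasure (E n)) : Continuous (measureFourier μ) := by
  obtain ⟨h, hi, hnorm, hμ⟩ := exists_cintegral_eq μ
  have e : measureFourier μ = fun ξ =>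
      ∫ y, Complex.exp (-(Complex.I * (inner ℝ y ξ : ℝ))) * h y ∂μ.variation := by
    ext ξ
    exact hμ _
  rw [e]
  refine continuous_of_dominated (bound := fun y => ‖h y‖)
    (fun ξ => (Continuous.aestronglyMeasurable (by fun_prop)).mul hi.1)
    (fun ξ => Filter.Eventually.of_forall fun y => ?_) hi.norm
    (Filter.Eventually.of_forall fun y => by fun_prop)
  rw [norm_mul, norm_exp_neg_I_mul_inner, one_mul]

/-- On the Fourier side, `M_μ^t - 1` is multiplication by `μ̂(t·) - 1`. -/
theorem fourierLpTwoPi_averageOp_sub (hn : n ≠ 0) {f : E n → ℂ} {p : ℝ} (hp1 : 1 ≤ p)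
    (hp2 : p ≤ 2) (hf : MemLp f (ENNReal.ofReal p) volume) (μ : ComplexMeasure (E n)) (t : ℝ)
    (hd : MemLp (fun x => averageOp μ t f x - f x) (ENNReal.ofReal p) volume) :
    fourierLpTwoPi (fun x => averageOp μ t f x - f x) =ᵐ[volume] fun ξ =>
      (measureFourier μ ((2 * Real.pi * t) • ξ) - 1) * fourierLpTwoPi f ξ := by
  have hG := locallyIntegrable_fourierLpTwoPi hn hp1 hp2 hf
  have hm : Continuous fun ξ : E n => measureFourier μ ((2 * Real.pi * t) • ξ) :=
    (continuous_measureFourier μ).comp (by fun_prop)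
  have hmG : LocallyIntegrable (fun ξ => measureFourier μ ((2 * Real.pi * t) • ξ) *
      fourierLpTwoPi f ξ) volume := by
    simpa only [smul_eq_mul] using hG.continuous_smul hm
  have hR : LocallyIntegrable (fun ξ => (measureFourier μ ((2 * Real.pi * t) • ξ) - 1) *
      fourierLpTwoPi f ξ) volume := by
    simp only [sub_mul, one_mul]
    exact hmG.sub hG
  refine ae_eq_of_integral_contDiff_smul_eq (locallyIntegrable_fourierLpTwoPi hn hp1 hp2 hd) hR ?_
  intro g hg hgc
  have hgc' : HasCompactSupport (fun x => (g x : ℂ)) := hgc.comp_left (g := fun r : ℝ => (r : ℂ)) rfl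
  let φ : SchwartzMap (E n) ℂ := hgc'.toSchwartzMap (Complex.ofRealCLM.contDiff.comp hg)
  have hφ : ∀ x, φ x = (g x : ℂ) := fun x => rfl
  have hφc : HasCompactSupport φ := hgc'
  obtain ⟨i1, e1⟩ := integral_averageOp_mul_fourier_eq hn hp1 hp2 hf μ t φ hφc
  have e2 := integral_mul_fourier_eq hp1 hp2 hf φ
  have e3 := integral_mul_fourier_eq hp1 hp2 hd φ
  have i2 := integrable_mul_schwartz hp1 hf (𝓕 φ)
  have i3 : Integrable (fun ξ => measureFourier μ ((2 * Real.pi * t) • ξ) *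
      fourierLpTwoPi f ξ * φ ξ) volume := by
    simpa only [smul_eq_mul, mul_comm] using
      hmG.integrable_smul_left_of_hasCompactSupport φ.continuous hφc
  have i4 : Integrable (fun ξ => fourierLpTwoPi f ξ * φ ξ) volume := by
    simpa only [smul_eq_mul, mul_comm] using
      hG.integrable_smul_left_of_hasCompactSupport φ.continuous hφc
  simp only [sub_mul] at e3
  rw [integral_sub i1 i2, e1, e2, ← integral_sub i3 i4] at e3
  simp only [Complex.real_smul, ← hφ]
  calc ∫ x, φ x * fourierLpTwoPi (fun x => averageOp μ t f x - f x) x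
      = ∫ x, fourierLpTwoPi (fun x => averageOp μ t f x - f x) x * φ x := by
        simp only [mul_comm]
    _ = _ := by
        rw [← e3]
        exact integral_congr_ae (Filter.Eventually.of_forall fun x => by simp only; ring)

/-! ### Dyadic summation and integrability of the transform -/

/-- Where `t‖ξ‖ ≥ 1`, the transform of `f` is dominated by that of `M_μ^t f - f`. -/
theorem exists_enorm_fourierLpTwoPi_le (hn : n ≠ 0) {σ : ℝ} {μ : ComplexMeasure (E n)}
    (hμ : IsKClass σ μ) :
    ∃ K : ℝ, 0 ≤ K ∧ ∀ (f : E n → ℂ) (p t : ℝ), 1 ≤ p → p ≤ 2 → 0 < t →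
      MemLp f (ENNReal.ofReal p) volume →
      MemLp (fun x => averageOp μ t f x - f x) (ENNReal.ofReal p) volume →
      ∀ᵐ ξ, 1 ≤ t * ‖ξ‖ → ‖fourierLpTwoPi f ξ‖ₑ ≤
        ENNReal.ofReal K * ‖fourierLpTwoPi (fun x => averageOp μ t f x - f x) ξ‖ₑ := by
  obtain ⟨c, C, hc, -, h⟩ := hμ.estimate
  refine ⟨c⁻¹, by positivity, fun f p t hp1 hp2 ht hf hd => ?_⟩
  filter_upwards [fourierLpTwoPi_averageOp_sub hn hp1 hp2 hf μ t hd] with ξ hξ h1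
  rw [hξ, ← ofReal_norm, ← ofReal_norm, ← ENNReal.ofReal_mul (by positivity)]
  refine ENNReal.ofReal_le_ofReal ?_
  have h2 : 1 ≤ ‖(2 * Real.pi * t) • ξ‖ := by
    rw [norm_smul, Real.norm_of_nonneg (by positivity)]
    -- The factor `2π > 1` only enlarges the argument, so the minimum in the estimate on `μ̂` is
    -- `1`.
    nlinarith [Real.pi_gt_three]
  have h3 : c ≤ ‖measureFourier μ ((2 * Real.pi * t) • ξ) - 1‖ := by
    have := (h ((2 * Real.pi * t) • ξ)).1
    rwa [min_eq_left (Real.one_le_rpow h2 (by linarith [hμ.sigma_pos])), mul_one,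
      norm_sub_rev] at this
  rw [norm_mul, ← mul_assoc]
  refine le_mul_of_one_le_left (norm_nonneg _) ?_
  rw [← div_eq_inv_mul, one_le_div hc]
  exact h3

/-- On the annulus of radius about `2^k`, taking `t = 2^{-k}` weighs the decay `t^α` against the
growth `2^{kn/p}` of the ball bound. -/
theorem integrable_fourierLpTwoPi (hn : n ≠ 0) {p σ α : ℝ} (hp1 : 1 ≤ p) (hp2 : p ≤ 2)
    {μ : ComplexMeasure (E n)} (hμ : IsKClass σ μ) {f : E n → ℂ}
    (hf : MemLp f (ENNReal.ofReal p) volume) (hα : (n : ℝ) / p < α)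
    (hlip : ∃ C : ℝ, ∀ᶠ t in 𝓝[>] (0 : ℝ),
      eLpNorm (fun x => averageOp μ t f x - f x) (ENNReal.ofReal p) volume ≤
        ENNReal.ofReal (C * t ^ α)) :
    Integrable (fourierLpTwoPi f) volume := by
  obtain ⟨C, hC⟩ := hlip
  obtain ⟨K, hK0, hK⟩ := exists_setLIntegral_ball_fourierLpTwoPi_le hn hp1 hp2
  obtain ⟨K', hK'0, hK'⟩ := exists_enorm_fourierLpTwoPi_le hn hμ
  have ht : Filter.Tendsto (fun k : ℕ => ((2 : ℝ)⁻¹) ^ k) Filter.atTop (𝓝[>] 0) :=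
    tendsto_nhdsWithin_iff.2 ⟨tendsto_pow_atTop_nhds_zero_of_lt_one (by norm_num) (by norm_num),
      Filter.Eventually.of_forall fun k => by simp⟩
  obtain ⟨k₀, hk₀⟩ := Filter.eventually_atTop.1 (ht.eventually hC)
  -- The given `C` may be zero or negative, while the ball bound asks for a positive `N`.
  set C' := |C| + 1
  set s := (n : ℝ) / p
  set q : ℝ := 2 ^ (s - α) with hq
  set A : ℝ := K' * (K * C' * 2 ^ s) with hA
  let D : ℕ → Set (E n) := fun k => {ξ | (2 : ℝ) ^ k ≤ ‖ξ‖ ∧ ‖ξ‖ < 2 ^ (k + 1)}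
  have hDm : ∀ k, MeasurableSet (D k) := fun k =>
    (measurableSet_le measurable_const measurable_norm).inter
      (measurableSet_lt measurable_norm measurable_const)
  have hD : ∀ k, k₀ ≤ k →
      ∫⁻ ξ in D k, ‖fourierLpTwoPi f ξ‖ₑ ≤ ENNReal.ofReal (A * q ^ k) := by
    intro k hk
    set t : ℝ := (2 : ℝ)⁻¹ ^ k with htk
    have ht0 : 0 < t := by positivity
    set N : ℝ := C' * t ^ α with hN
    have hN0 : 0 < N := by positivity
    have hdN : eLpNorm (fun x => averageOp μ t f x - f x) (ENNReal.ofReal p) volume ≤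
        ENNReal.ofReal N := by
      refine (hk₀ k hk).trans (ENNReal.ofReal_le_ofReal ?_)
      rw [hN]
      gcongr
      exact (le_abs_self C).trans (by simp [C'])
    have hd : MemLp (fun x => averageOp μ t f x - f x) (ENNReal.ofReal p) volume :=
      ⟨(aestronglyMeasurable_averageOp hf.1 μ t).sub hf.1, hdN.trans_lt ENNReal.ofReal_lt_top⟩
    -- The annulus lies in the ball of radius `2^{k+1}`; the extra factor `2^s` is absorbed into
    -- `A`.
    have e : K' * (K * N * (2 ^ (k + 1)) ^ s) = A * q ^ k := by
      have e1 : t ^ α = (2 : ℝ) ^ (-α * k) := by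
        rw [htk, ← Real.rpow_natCast, ← Real.rpow_mul (by norm_num), Real.inv_rpow (by norm_num),
          ← Real.rpow_neg (by norm_num)]
        congr 1
        ring
      have e2 : ((2 : ℝ) ^ (k + 1)) ^ s = 2 ^ s * 2 ^ (s * k) := by
        rw [← Real.rpow_natCast, ← Real.rpow_mul (by norm_num), ← Real.rpow_add (by norm_num)]
        congr 1
        push_cast
        ring
      have e3 : q ^ k = (2 : ℝ) ^ (s * k) * 2 ^ (-α * k) := by
        rw [hq, ← Real.rpow_natCast, ← Real.rpow_mul (by norm_num), ← Real.rpow_add (by norm_num)]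
        congr 1
        ring
      rw [hN, e1, e2, e3, hA]
      ring
    calc ∫⁻ ξ in D k, ‖fourierLpTwoPi f ξ‖ₑ
        ≤ ∫⁻ ξ in D k, ENNReal.ofReal K' *
            ‖fourierLpTwoPi (fun x => averageOp μ t f x - f x) ξ‖ₑ := by
          refine setLIntegral_mono_ae' (hDm k) ?_
          filter_upwards [hK' f p t hp1 hp2 ht0 hf hd] with ξ hξ hξD
          refine hξ ?_
          rw [htk, inv_pow, ← div_eq_inv_mul, one_le_div (by positivity)]
          exact hξD.1
      _ = ENNReal.ofReal K' * ∫⁻ ξ in D k,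
            ‖fourierLpTwoPi (fun x => averageOp μ t f x - f x) ξ‖ₑ :=
          lintegral_const_mul' _ _ ENNReal.ofReal_ne_top
      _ ≤ ENNReal.ofReal K' * ENNReal.ofReal (K * N * (2 ^ (k + 1)) ^ s) := by
          gcongr
          refine (lintegral_mono_set fun ξ hξ => ?_).trans
            (hK _ N (2 ^ (k + 1)) hN0 (by positivity) hd hdN)
          simpa using hξ.2
      _ = ENNReal.ofReal (A * q ^ k) := by rw [← ENNReal.ofReal_mul hK'0, e]
  have hcover : (Set.univ : Set (E n)) ⊆ Metric.ball 0 (2 ^ k₀) ∪ ⋃ j, D (k₀ + j) := by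
    intro ξ _
    by_cases hξ : ‖ξ‖ < 2 ^ k₀
    · left
      simpa using hξ
    · right
      have h1 : (1 : ℝ) ≤ ‖ξ‖ := (one_le_pow₀ one_le_two).trans (not_lt.1 hξ)
      obtain ⟨k, hk1, hk2⟩ := exists_nat_pow_near h1 one_lt_two
      have hk : k₀ ≤ k := by
        by_contra hlt
        exact hξ (hk2.trans_le (pow_le_pow_right₀ one_le_two (by omega)))
      refine Set.mem_iUnion.2 ⟨k - k₀, ?_⟩
      rw [Nat.add_sub_cancel' hk]
      exact ⟨hk1, hk2⟩
  have hq0 : 0 ≤ q := by positivity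
  -- This is where `α > n/p` enters.
  have hq1 : q < 1 := Real.rpow_lt_one_of_one_lt_of_neg one_lt_two (by linarith)
  have hfN : eLpNorm f (ENNReal.ofReal p) volume ≤
      ENNReal.ofReal ((eLpNorm f (ENNReal.ofReal p) volume).toReal + 1) := by
    rw [ENNReal.ofReal_add ENNReal.toReal_nonneg zero_le_one, ENNReal.ofReal_toReal hf.2.ne]
    exact le_self_add
  have hA0 : 0 ≤ A := by positivity
  have hsum : Summable fun j : ℕ => A * q ^ (k₀ + j) := by
    simp only [pow_add, ← mul_assoc]
    exact (summable_geometric_of_lt_one hq0 hq1).mul_left _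
  refine ⟨aestronglyMeasurable_fourierLpTwoPi hp1 hp2 hf, ?_⟩
  calc ∫⁻ ξ, ‖fourierLpTwoPi f ξ‖ₑ
      = ∫⁻ ξ in Set.univ, ‖fourierLpTwoPi f ξ‖ₑ := by rw [setLIntegral_univ]
    _ ≤ ∫⁻ ξ in Metric.ball 0 (2 ^ k₀) ∪ ⋃ j, D (k₀ + j), ‖fourierLpTwoPi f ξ‖ₑ :=
        lintegral_mono_set hcover
    _ ≤ (∫⁻ ξ in Metric.ball 0 (2 ^ k₀), ‖fourierLpTwoPi f ξ‖ₑ) +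
          ∫⁻ ξ in ⋃ j, D (k₀ + j), ‖fourierLpTwoPi f ξ‖ₑ := lintegral_union_le _ _ _
    _ ≤ (∫⁻ ξ in Metric.ball 0 (2 ^ k₀), ‖fourierLpTwoPi f ξ‖ₑ) +
          ∑' j, ENNReal.ofReal (A * q ^ (k₀ + j)) := by
        gcongr
        exact (lintegral_iUnion_le _ _).trans
          (ENNReal.tsum_le_tsum fun j => hD _ (Nat.le_add_right _ _))
    _ < ∞ := by
        rw [← ENNReal.ofReal_tsum_of_nonneg (fun j => by positivity) hsum]
        exact ENNReal.add_lt_top.2 ⟨(hK f _ _ (by positivity) (by positivity) hf hfN).trans_lt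
          ENNReal.ofReal_lt_top, ENNReal.ofReal_lt_top⟩

/-! ### Fourier inversion -/

/-- Fourier inversion for `Lᵖ` functions with integrable transform. -/
theorem ae_eq_fourierInv_fourierLpTwoPi {p : ℝ} (hp1 : 1 ≤ p) (hp2 : p ≤ 2) {f : E n → ℂ}
    (hf : MemLp f (ENNReal.ofReal p) volume) (hi : Integrable (fourierLpTwoPi f) volume) :
    f =ᵐ[volume] 𝓕⁻ (fourierLpTwoPi f) := by
  have einv : 𝓕⁻ (fourierLpTwoPi f) = fun x => 𝓕 (fourierLpTwoPi f) (-x) := by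
    ext x
    exact Real.fourierInv_eq_fourier_neg _ _
  have hc : Continuous (𝓕⁻ (fourierLpTwoPi f)) := by
    rw [einv]
    exact (VectorFourier.fourierIntegral_continuous Real.continuous_fourierChar
      (innerSL ℝ).continuous₂ hi).comp continuous_neg
  refine ae_eq_of_integral_contDiff_smul_eq (hf.locallyIntegrable (by simpa using hp1))
    hc.locallyIntegrable fun g hg hgc => ?_
  have hgc' : HasCompactSupport (fun x => (g x : ℂ)) := hgc.comp_left (g := fun r : ℝ => (r : ℂ)) rfl
  let φ : SchwartzMap (E n) ℂ := hgc'.toSchwartzMap (Complex.ofRealCLM.contDiff.comp hg)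
  have hφ : ∀ x, φ x = (g x : ℂ) := fun x => rfl
  -- Taking `𝓕⁻ φ` as the test function gives `∫ f φ = ∫ f̂ 𝓕⁻ φ`; it remains to move `𝓕⁻` onto `f̂
  -- ∈ L¹`.
  have e1 := integral_mul_fourier_eq hp1 hp2 hf (𝓕⁻ φ)
  rw [FourierTransform.fourier_fourierInv_eq] at e1
  -- For the pairing `-⟨x, ξ⟩` the general Fourier integral is the inverse transform, so the `L¹`
  -- multiplication formula applies to `𝓕⁻`.
  have e2 := VectorFourier.integral_fourierIntegral_smul_eq_flip (L := -innerₗ (E n)) (μ := volume)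
    (ν := volume) Real.continuous_fourierChar (by
      simp only [LinearMap.neg_apply]
      exact continuous_inner.neg) hi φ.integrable
  simp only [smul_eq_mul] at e2
  have e3 : ∀ (u : E n → ℂ) (x : E n),
      VectorFourier.fourierIntegral Real.fourierChar volume (-innerₗ (E n)) u x = 𝓕⁻ u x := by
    intro u x
    rw [Real.fourierInv_eq, VectorFourier.fourierIntegral]
    simp
  have e4 : ∀ (u : E n → ℂ) (x : E n),
      VectorFourier.fourierIntegral Real.fourierChar volume (-innerₗ (E n)).flip u x
        = 𝓕⁻ u x := by
    intro u x
    rw [Real.fourierInv_eq, VectorFourier.fourierIntegral]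
    simp [real_inner_comm]
  simp only [e3, e4] at e2
  simp only [Complex.real_smul, ← hφ]
  rw [SchwartzMap.fourierInv_coe] at e1
  calc ∫ x, φ x * f x = ∫ x, f x * φ x := by simp only [mul_comm]
    _ = ∫ x, 𝓕⁻ (fourierLpTwoPi f) x * φ x := by rw [e1, e2]
    _ = _ := by simp only [mul_comm]

theorem integrable_fourierLp_iff {f : E n → ℂ} :
    Integrable (fourierLp f) volume ↔ Integrable (fourierLpTwoPi f) volume :=
  (integrable_comp_smul_iff volume (fourierLp f) (by positivity)).symm

theorem inversionIntegral_fourierLp (f : E n → ℂ) (x : E n) :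
    inversionIntegral (fourierLp f) x = 𝓕⁻ (fourierLpTwoPi f) x := by
  -- The substitution `ξ ↦ 2πξ` has Jacobian `(2π)^n`, which accounts for the constant in
  -- `inversionIntegral`.
  have e := Measure.integral_comp_smul (volume : Measure (E n))
    (fun ξ => fourierLp f ξ * Complex.exp (Complex.I * (inner ℝ x ξ : ℝ))) (2 * Real.pi)
  rw [finrank_euclideanSpace_fin, abs_of_nonneg (by positivity)] at e
  rw [inversionIntegral, Real.fourierInv_eq']
  rw [Complex.real_smul] at e
  push_cast at e
  rw [← e]
  refine integral_congr_ae (Filter.Eventually.of_forall fun ξ => ?_)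
  simp only [fourierLpTwoPi, smul_eq_mul, inner_smul_right, real_inner_comm x ξ]
  rw [mul_comm]
  congr 2
  push_cast
  ring

end FourierGrowth

theorem mainTheorem3 (n : ℕ) (hn : 2 ≤ n) (p σ α : ℝ) (hp1 : 1 ≤ p) (hp2 : p ≤ 2)
    (hσ : (n : ℝ) / p < 2 * σ) (μ : ComplexMeasure (FourierGrowth.E n))
    (hμ : FourierGrowth.IsKClass σ μ)
    (f : FourierGrowth.E n → ℂ) (hf : MemLp f (ENNReal.ofReal p) volume)
    (hα1 : (n : ℝ) / p < α) (hα2 : α ≤ 2 * σ)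
    (hlip : ∃ C : ℝ, ∀ᶠ t in 𝓝[>] (0 : ℝ),
      eLpNorm (fun x => FourierGrowth.averageOp μ t f x - f x) (ENNReal.ofReal p) volume ≤
        ENNReal.ofReal (C * t ^ α)) :
    Integrable (FourierGrowth.fourierLp f) volume ∧
      ∀ᵐ x ∂(volume : Measure (FourierGrowth.E n)),
        f x = FourierGrowth.inversionIntegral (FourierGrowth.fourierLp f) x := by
  have hi := FourierGrowth.integrable_fourierLpTwoPi (by omega) hp1 hp2 hμ hf hα1 hlip
  refine ⟨FourierGrowth.integrable_fourierLp_iff.2 hi, ?_⟩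
  filter_upwards [FourierGrowth.ae_eq_fourierInv_fourierLpTwoPi hp1 hp2 hf hi] with x hx
  rw [FourierGrowth.inversionIntegral_fourierLp]
  exact hx
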